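/- Let $q$ be a power of a prime and let $\phi\colon \mathbb{F}_q[T]\to \mathrm{End}_{\mathbb{F}_q(T)}(\mathbb{G}_a)$ be a Drinfeld module of rank $2$ given by $$\phi_T(x)=Tx+gx^q+\Delta x^{q^2},\qquad g,\Delta\in\mathbb{F}_q[T],\ \Delta\neq 0.$$ Suppose that $\Delta$ splits completely over $\mathbb{F}_q$ (it is a product of polynomials of degree at most $1$ in $\mathbb{F}_q[T]$) and that $\phi_T(1)=T+g+\Delta$ is coprime to $T\Delta$ in $\mathbb{F}_q[T]$. Let $S$ be the finite set of places of $\mathbb{F}_q(T)$ consisting of the places dividing $T\Delta$ and the place $v_\infty$ at infinity. For $x\in\mathbb{F}_q(T)$ and $n\ge 0$ write $\phi_{T^n}(x)=\mathfrak{A}_n\mathfrak{B}_n^{-1}$ with $\mathfrak{A}_n,\mathfrak{B}_n\in\mathbb{F}_q[T]$ coprime, and let $\mathcal{Z}(\phi,x)$ be the set of $n\ge 1$ such that $\mathfrak{A}_n$ has no primitive divisor, that is, no prime element $\mathfrak{p}$ of $\mathbb{F}_q[T]$ satisfies $\mathfrak{p}\mid\mathfrak{A}_n$ and $\mathfrak{p}\nmid\mathfrak{A}_i$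 for all $0\le i<n$. If $x\in\mathbb{F}_q[T]$ is not a torsion point of $\phi$ (that is, $\phi_a(x)\ne 0$ for every nonzero $a\in\mathbb{F}_q[T]$), then $\mathcal{Z}(\phi,x)$ is finite and every $n\in\mathcal{Z}(\phi,x)$ satisfies $$n\le \bigl(6(q^2-1)|S|+4\bigr)+\tfrac12\log_q\bigl(2+2\deg g+2\deg\Delta\bigr),$$ where $\deg g$ is read as $0$ if $g=0$. -/

import Mathlib

open Polynomial

/-- A Drinfeld `F[T]`-module over a field `K` that is an `F[T]`-algebra, where `F` is a finite field
with `q` elements (the variable `T` of `F[T]` is the `X` of `F[X]`). It is a ring homomorphism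
`a ↦ φ_a` from `F[T]` to the ring `End_K(𝔾_a)` of `q`-polynomials `∑ cᵢ x ^ (q ^ i)` over `K`, with
addition of polynomials and composition as operations, that sends a constant `c ∈ F` to `c x`, such
that the linear coefficient of `φ_a` is `a`, and that is not the trivial homomorphism `a ↦ a x`. -/
structure DrinfeldModule (F : Type*) [Field F] [Fintype F] (K : Type*) [Field K]
    [Algebra F[X] K] where
  /-- the polynomial `φ_a` -/
  poly : F[X] → K[X]
  poly_C : ∀ c : F, poly (C c) = C (algebraMap F[X] K (C c)) * X
  poly_add : ∀ a b : F[X], poly (a + b) = poly a + poly b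
  poly_mul : ∀ a b : F[X], poly (a * b) = (poly a).comp (poly b)
  additive : ∀ (a : F[X]) (n : ℕ), (poly a).coeff n ≠ 0 → ∃ i : ℕ, n = Fintype.card F ^ i
  coeff_one : ∀ a : F[X], (poly a).coeff 1 = algebraMap F[X] K a
  nontrivial : ∃ a : F[X], poly a ≠ C (algebraMap F[X] K a) * X

namespace DrinfeldModule

variable {F : Type*} [Field F] [Fintype F]

/-- The point `φ_a(x)`. -/
noncomputable def act {K : Type*} [Field K] [Algebra F[X] K] (φ : DrinfeldModule F K)
    (a : F[X]) (x : K) : K :=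
  (φ.poly a).eval x

/-- `φ` has rank `r`: the polynomial `φ_T` has degree `q ^ r`. -/
def HasRank {K : Type*} [Field K] [Algebra F[X] K] (φ : DrinfeldModule F K) (r : ℕ) : Prop :=
  (φ.poly X).natDegree = Fintype.card F ^ r

/-- `x` is a torsion point of `φ`: it is killed by some nonzero element of `F[T]`. -/
def IsTorsionPoint {K : Type*} [Field K] [Algebra F[X] K] (φ : DrinfeldModule F K)
    (x : K) : Prop :=
  ∃ a : F[X], a ≠ 0 ∧ φ.act a x = 0

/-- The numerator `𝔄_n` of `φ_{T^n}(x) = 𝔄_n / 𝔅_n`, written in lowest terms. -/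
noncomputable def orbitNum (φ : DrinfeldModule F (RatFunc F)) (x : RatFunc F) (n : ℕ) : F[X] :=
  (φ.act (X ^ n) x).num

/-- `p` is a primitive divisor of `𝔄_n`: a prime of `F[T]` that divides `𝔄_n` but none of
`𝔄_0, …, 𝔄_{n-1}`. -/
def IsPrimitiveDivisor (φ : DrinfeldModule F (RatFunc F)) (x : RatFunc F) (n : ℕ)
    (p : F[X]) : Prop :=
  Prime p ∧ p ∣ φ.orbitNum x n ∧ ∀ i < n, ¬ p ∣ φ.orbitNum x i

/-- The Zsigmondy set `𝒵(φ, x)`. -/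
def zsigmondySet (φ : DrinfeldModule F (RatFunc F)) (x : RatFunc F) : Set ℕ :=
  {n | 1 ≤ n ∧ ¬ ∃ p : F[X], φ.IsPrimitiveDivisor x n p}

end DrinfeldModule

/-- The places of the rational function field `F(T)` over a finite field `F`: the finite ones, given
by the nonzero prime ideals of `F[T]`, and the place at infinity. -/
inductive RatPlace (F : Type*) [Field F] where
  | finite (v : IsDedekindDomain.HeightOneSpectrum F[X]) : RatPlace F
  | infinity : RatPlace F

/-- `v ∣ a`, that is `v(a) > 0`, for a place `v` of `F(T)` and a polynomial `a ∈ F[T]`, `a ≠ 0`. The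
place at infinity divides no nonzero polynomial. -/
def RatPlace.Divides {F : Type*} [Field F] : RatPlace F → F[X] → Prop
  | .finite v, a => a ∈ v.asIdeal
  | .infinity, _ => False

/-- The set `S = {v : v ∣ T Δ} ∪ {v_∞}` of places of `F(T)`. -/
def badPlaces {F : Type*} [Field F] (Δ : F[X]) : Set (RatPlace F) :=
  {v | v.Divides (X * Δ)} ∪ {RatPlace.infinity}

/-!
The orbit `a_n = φ_{T^n}(x)` of a polynomial `x` consists of polynomials, and
`a_{n+1} = R(a_n) a_n` with `R(a) = T + g a^{q-1} + Δ a^{q²-1}`. A prime dividing some `a_i` divides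
all later ones, so `n + 1` lies in the Zsigmondy set exactly when every prime dividing `a_{n+1}`
divides `a_n`. As `R(a) ≡ T` modulo `a`, every prime dividing `R(a_n)` then divides `T`
(`dvd_X_of_dvd_stepRatio`). This forces much more than the stated bound: the Zsigmondy set is
contained in `{1}`.

* The condition on `φ_T(1)` says that `g + Δ` does not vanish at `0`, so modulo `T` the map `φ_T` is
  multiplication by a nonzero constant, and `T ∣ a_n` if and only if `T ∣ x`.
* If `T ∤ x`, then `R(a_n)` is a nonzero constant `c`, so `φ_{T - c}` kills `a_n` and `x` is torsion.
* If `T ∣ x`, then `T² ∣ a_n` for `n ≥ 1`, so `R(a_n) ≡ T` modulo `T²`, which leaves only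
  `R(a_n) = T`, that is, `g = -Δ a_n^{q²-q}`. With `y = a_{n-1}` and `m = R(y)`, so that
  `a_n = m y`, this gives `m - T = Δ y^{q²-1} (1 - m^{q²-q})`. Comparing degrees shows that `m` is
  constant (`natDegree_stepRatio_eq_zero`), and `x` is torsion as before.
-/

section PolynomialOrbit

variable {F : Type*} [Field F] [Fintype F]

/-! ### The dynamics on polynomials -/

/-- The map `a ↦ T a + g a ^ q + Δ a ^ (q ^ 2)` on `F[T]`. -/
noncomputable def step (g Δ a : F[X]) : F[X] :=
  X * a + g * a ^ Fintype.card F + Δ * a ^ (Fintype.card F ^ 2)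

/-- The cofactor `T + g a ^ (q - 1) + Δ a ^ (q ^ 2 - 1)` of `a` in `step g Δ a`. -/
noncomputable def stepRatio (g Δ a : F[X]) : F[X] :=
  X + g * a ^ (Fintype.card F - 1) + Δ * a ^ (Fintype.card F ^ 2 - 1)

theorem step_eq_stepRatio_mul (g Δ a : F[X]) : step g Δ a = stepRatio g Δ a * a := by
  have hq : 1 < Fintype.card F := Fintype.one_lt_card
  have h1 : a ^ Fintype.card F = a ^ (Fintype.card F - 1) * a := by
    rw [← pow_succ, Nat.sub_add_cancel hq.le]
  have h2 : a ^ (Fintype.card F ^ 2) = a ^ (Fintype.card F ^ 2 - 1) * a := by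
    rw [← pow_succ, Nat.sub_add_cancel (Nat.one_le_pow _ _ (by lia))]
  rw [step, stepRatio, h1, h2]
  ring

theorem dvd_stepRatio_sub_X (g Δ a : F[X]) : a ∣ stepRatio g Δ a - X := by
  have hq : 1 < Fintype.card F := Fintype.one_lt_card
  have hq2 : 1 < Fintype.card F ^ 2 := Nat.one_lt_pow two_ne_zero hq
  have h : stepRatio g Δ a - X =
      g * a ^ (Fintype.card F - 1) + Δ * a ^ (Fintype.card F ^ 2 - 1) := by
    rw [stepRatio]; ring
  rw [h]
  exact dvd_add ((dvd_pow_self a (by lia)).mul_left g) ((dvd_pow_self a (by lia)).mul_left Δ)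

/-- The sequence `x, φ_T(x), φ_{T^2}(x), …` in `F[T]`. -/
noncomputable def polyOrbit (g Δ x : F[X]) (n : ℕ) : F[X] :=
  (step g Δ)^[n] x

theorem polyOrbit_succ (g Δ x : F[X]) (n : ℕ) :
    polyOrbit g Δ x (n + 1) = step g Δ (polyOrbit g Δ x n) :=
  Function.iterate_succ_apply' _ _ _

theorem polyOrbit_dvd_of_le (g Δ x : F[X]) {i j : ℕ} (hij : i ≤ j) :
    polyOrbit g Δ x i ∣ polyOrbit g Δ x j := by
  induction j, hij using Nat.le_induction with
  | base => rfl
  | succ k _ ih =>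
    rw [polyOrbit_succ, step_eq_stepRatio_mul]
    exact ih.mul_left _

/-- Modulo `T` the map `φ_T` is multiplication by `g(0) + Δ(0)`, because `a ^ q = a` on `F`. -/
theorem X_dvd_of_X_dvd_polyOrbit {g Δ x : F[X]} (h0 : (g + Δ).eval 0 ≠ 0) {n : ℕ}
    (h : X ∣ polyOrbit g Δ x n) : X ∣ x := by
  induction n with
  | zero => exact h
  | succ n ih =>
    apply ih
    rw [X_dvd_iff, coeff_zero_eq_eval_zero] at h ⊢
    rw [polyOrbit_succ, step] at h
    simp only [eval_add, eval_mul, eval_X, eval_pow, zero_mul, zero_add, FiniteField.pow_card,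
      FiniteField.pow_card_pow, ← add_mul] at h
    rw [eval_add] at h0
    exact (mul_eq_zero.mp h).resolve_left h0

theorem X_sq_dvd_step {g Δ a : F[X]} (h : X ∣ a) : X ^ 2 ∣ step g Δ a := by
  have hR : X ∣ stepRatio g Δ a := by
    have := dvd_add (h.trans (dvd_stepRatio_sub_X g Δ a)) dvd_rfl
    rwa [sub_add_cancel] at this
  rw [step_eq_stepRatio_mul, sq]
  exact mul_dvd_mul hR h

/-- If `φ_T` creates no new prime divisor at `a`, then only `T` can divide the cofactor, which is
congruent to `T` modulo `a`. -/
theorem dvd_X_of_dvd_stepRatio {g Δ a : F[X]}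
    (h : ∀ p : F[X], Prime p → p ∣ step g Δ a → p ∣ a)
    {p : F[X]} (hp : Prime p) (hpR : p ∣ stepRatio g Δ a) : p ∣ X := by
  have hpa : p ∣ a := h p hp (by rw [step_eq_stepRatio_mul]; exact hpR.mul_right a)
  exact (dvd_sub_right hpR).mp (hpa.trans (dvd_stepRatio_sub_X g Δ a))

theorem isUnit_of_forall_not_prime_dvd {K : Type*} [Field K] {r : K[X]} (hr : r ≠ 0)
    (h : ∀ p : K[X], Prime p → ¬ p ∣ r) : IsUnit r := by
  by_contra hu
  obtain ⟨p, hp, hpr⟩ := WfDvdMonoid.exists_irreducible_factor hu hr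
  exact h p hp.prime hpr

/-- If `T ^ 2 ∣ a` and `φ_T` creates no new prime divisor at `a`, then `φ_T(a) = T a`. -/
theorem stepRatio_eq_X {g Δ a : F[X]} (hne : step g Δ a ≠ 0) (hX : X ^ 2 ∣ a)
    (h : ∀ p : F[X], Prime p → p ∣ step g Δ a → p ∣ a) : stepRatio g Δ a = X := by
  obtain ⟨w, hw⟩ := hX.trans (dvd_stepRatio_sub_X g Δ a)
  have hR : stepRatio g Δ a = X * (1 + X * w) := by linear_combination hw
  have hu : IsUnit (1 + X * w) := by
    refine isUnit_of_forall_not_prime_dvd (fun h0 ↦ hne ?_) fun p hp hdvd ↦ hp.not_isUnit ?_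
    · rw [step_eq_stepRatio_mul, hR, h0]; ring
    · have hpX := dvd_X_of_dvd_stepRatio h hp (hR ▸ hdvd.mul_left X)
      exact isUnit_of_dvd_one ((dvd_add_left (hpX.mul_right w)).mp hdvd)
  have hw0 : w = 0 := by
    by_contra hw0
    have h1 : (X * w).natDegree = 0 := by
      have := natDegree_eq_zero_of_isUnit hu
      rwa [natDegree_add_eq_right_of_natDegree_lt] at this
      rw [natDegree_one, natDegree_X_mul hw0]; lia
    rw [natDegree_X_mul hw0] at h1
    lia
  rw [hR, hw0]; ring

/-- If `φ_T(a) = T a`, then `g = -Δ a ^ (q ^ 2 - q)`; for a preimage `y` of `a` this is an equation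
for the quotient `a / y`, which a comparison of degrees shows to be constant. -/
theorem natDegree_stepRatio_eq_zero {g Δ y : F[X]} (hΔ : Δ ≠ 0) (hy : step g Δ y ≠ 0)
    (hX : X ∣ y) (h : stepRatio g Δ (step g Δ y) = X) : (stepRatio g Δ y).natDegree = 0 := by
  have hq : 1 < Fintype.card F := Fintype.one_lt_card
  have hqq : Fintype.card F * 2 ≤ Fintype.card F ^ 2 := by rw [sq]; gcongr; lia
  have hy0 : y ≠ 0 := by rintro rfl; exact hy (by rw [step_eq_stepRatio_mul, mul_zero])
  have hexp : Fintype.card F ^ 2 - 1 = Fintype.card F - 1 + (Fintype.card F ^ 2 - Fintype.card F) :=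
    by lia
  have hg : g = -(Δ * step g Δ y ^ (Fintype.card F ^ 2 - Fintype.card F)) := by
    have h1 : step g Δ y ^ (Fintype.card F - 1) *
        (g + Δ * step g Δ y ^ (Fintype.card F ^ 2 - Fintype.card F)) = 0 := by
      rw [stepRatio, hexp, pow_add] at h
      linear_combination h
    exact eq_neg_of_add_eq_zero_left ((mul_eq_zero.mp h1).resolve_left (pow_ne_zero _ hy))
  by_contra hm
  set m := stepRatio g Δ y with hm_def
  have key : m - X = Δ * y ^ (Fintype.card F ^ 2 - 1) *
      (1 - m ^ (Fintype.card F ^ 2 - Fintype.card F)) := by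
    rw [step_eq_stepRatio_mul, ← hm_def, mul_pow] at hg
    have h2 : m = X + g * y ^ (Fintype.card F - 1) + Δ * y ^ (Fintype.card F ^ 2 - 1) := hm_def
    rw [hexp, pow_add] at h2 ⊢
    linear_combination h2 + y ^ (Fintype.card F - 1) * hg
  have hdeg : (1 - m ^ (Fintype.card F ^ 2 - Fintype.card F)).natDegree =
      (Fintype.card F ^ 2 - Fintype.card F) * m.natDegree := by
    rw [natDegree_sub_eq_right_of_natDegree_lt, natDegree_pow]
    rw [natDegree_one, natDegree_pow]
    exact Nat.mul_pos (by lia) (by lia)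
  have hpos : 2 * m.natDegree ≤ (Fintype.card F ^ 2 - Fintype.card F) * m.natDegree := by
    gcongr; lia
  have hne : 1 - m ^ (Fintype.card F ^ 2 - Fintype.card F) ≠ 0 := by
    intro h0
    rw [h0, natDegree_zero] at hdeg
    lia
  have hdeg' := congrArg natDegree key
  rw [natDegree_mul (mul_ne_zero hΔ (pow_ne_zero _ hy0)) hne,
    natDegree_mul hΔ (pow_ne_zero _ hy0), hdeg, natDegree_pow] at hdeg'
  have hy1 : 1 ≤ y.natDegree := by simpa using natDegree_le_of_dvd hX hy0
  have hy2 : 3 * 1 ≤ (Fintype.card F ^ 2 - 1) * y.natDegree := Nat.mul_le_mul (by lia) hy1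
  have hsub := natDegree_sub_le m X
  rw [natDegree_X] at hsub
  lia

/-- From the second iterate on, every `φ_T`-step creates a new prime divisor. The hypotheses `hne`
and `hconst` hold when `x` is not a torsion point: they say that no `T ^ n` and no
`(T - c) * T ^ n` kills `x`. -/
theorem exists_prime_dvd_polyOrbit_not_dvd {g Δ x : F[X]} (hΔ : Δ ≠ 0) (h0 : (g + Δ).eval 0 ≠ 0)
    (hne : ∀ n, polyOrbit g Δ x n ≠ 0)
    (hconst : ∀ n (c : F), polyOrbit g Δ x (n + 1) ≠ C c * polyOrbit g Δ x n) (n : ℕ) :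
    ∃ p : F[X], Prime p ∧ p ∣ polyOrbit g Δ x (n + 2) ∧ ¬ p ∣ polyOrbit g Δ x (n + 1) := by
  by_contra! h
  have hnc : ∀ k, (stepRatio g Δ (polyOrbit g Δ x k)).natDegree ≠ 0 := by
    intro k hk
    apply hconst k ((stepRatio g Δ (polyOrbit g Δ x k)).coeff 0)
    rw [← eq_C_of_natDegree_eq_zero hk, polyOrbit_succ, step_eq_stepRatio_mul]
  have hstep := polyOrbit_succ g Δ x (n + 1)
  have hs := hne (n + 2)
  rw [hstep] at hs h
  by_cases hX : X ∣ x
  · have hX0 : X ∣ polyOrbit g Δ x 0 := hX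
    have hXn := hX0.trans (polyOrbit_dvd_of_le g Δ x n.zero_le)
    have hsucc := polyOrbit_succ g Δ x n
    have hne1 := hne (n + 1)
    rw [hsucc] at hne1 hs h
    have hR := stepRatio_eq_X hs (X_sq_dvd_step hXn) h
    exact hnc n (natDegree_stepRatio_eq_zero hΔ hne1 hXn hR)
  · refine hnc (n + 1) (natDegree_eq_zero_of_isUnit (isUnit_of_forall_not_prime_dvd ?_ ?_))
    · intro hR
      exact hs (by rw [step_eq_stepRatio_mul, hR, zero_mul])
    · intro p hp hpR
      have hpX := dvd_X_of_dvd_stepRatio h hp hpR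
      have hpa := h p hp (by rw [step_eq_stepRatio_mul]; exact hpR.mul_right _)
      have hXp : X ∣ p := (hp.associated_of_dvd prime_X hpX).symm.dvd
      exact hX (X_dvd_of_X_dvd_polyOrbit h0 (hXp.trans hpa))

end PolynomialOrbit

namespace DrinfeldModule

variable {F : Type*} [Field F] [Fintype F]

/-! ### The action of a Drinfeld module on polynomials -/

theorem act_add {K : Type*} [Field K] [Algebra F[X] K] (φ : DrinfeldModule F K) (a b : F[X])
    (x : K) : φ.act (a + b) x = φ.act a x + φ.act b x := by
  rw [act, φ.poly_add, eval_add, act, act]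

theorem act_mul {K : Type*} [Field K] [Algebra F[X] K] (φ : DrinfeldModule F K) (a b : F[X])
    (x : K) : φ.act (a * b) x = φ.act a (φ.act b x) := by
  rw [act, φ.poly_mul, eval_comp, act, act]

theorem act_C {K : Type*} [Field K] [Algebra F[X] K] (φ : DrinfeldModule F K) (c : F) (x : K) :
    φ.act (C c) x = algebraMap F[X] K (C c) * x := by
  rw [act, φ.poly_C, eval_mul, eval_C, eval_X]

theorem act_X_algebraMap {φ : DrinfeldModule F (RatFunc F)} {g Δ : F[X]}
    (hφ : φ.poly X = C (algebraMap F[X] (RatFunc F) X) * X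
      + C (algebraMap F[X] (RatFunc F) g) * X ^ Fintype.card F
      + C (algebraMap F[X] (RatFunc F) Δ) * X ^ (Fintype.card F ^ 2)) (a : F[X]) :
    φ.act X (algebraMap F[X] (RatFunc F) a) = algebraMap F[X] (RatFunc F) (step g Δ a) := by
  rw [act, hφ, step]
  simp only [eval_add, eval_mul, eval_C, eval_X, eval_pow, map_add, map_mul, map_pow]

theorem act_X_pow_algebraMap {φ : DrinfeldModule F (RatFunc F)} {g Δ : F[X]}
    (hφ : φ.poly X = C (algebraMap F[X] (RatFunc F) X) * X
      + C (algebraMap F[X] (RatFunc F) g) * X ^ Fintype.card F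
      + C (algebraMap F[X] (RatFunc F) Δ) * X ^ (Fintype.card F ^ 2)) (x : F[X]) (n : ℕ) :
    φ.act (X ^ n) (algebraMap F[X] (RatFunc F) x) =
      algebraMap F[X] (RatFunc F) (polyOrbit g Δ x n) := by
  induction n with
  | zero => rw [pow_zero, ← C_1, act_C, C_1, map_one, one_mul]; rfl
  | succ n ih => rw [pow_succ', act_mul, ih, act_X_algebraMap hφ, polyOrbit_succ]

theorem zsigmondySet_subset_singleton {φ : DrinfeldModule F (RatFunc F)} {g Δ : F[X]}
    (hΔ : Δ ≠ 0)
    (hφ : φ.poly X = C (algebraMap F[X] (RatFunc F) X) * X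
      + C (algebraMap F[X] (RatFunc F) g) * X ^ Fintype.card F
      + C (algebraMap F[X] (RatFunc F) Δ) * X ^ (Fintype.card F ^ 2))
    (h0 : (g + Δ).eval 0 ≠ 0) {x : F[X]}
    (hx : ¬ φ.IsTorsionPoint (algebraMap F[X] (RatFunc F) x)) :
    φ.zsigmondySet (algebraMap F[X] (RatFunc F) x) ⊆ {1} := by
  have horb : ∀ n, φ.orbitNum (algebraMap F[X] (RatFunc F) x) n = polyOrbit g Δ x n := fun n ↦ by
    rw [orbitNum, act_X_pow_algebraMap hφ, RatFunc.num_algebraMap]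
  have hne : ∀ n, polyOrbit g Δ x n ≠ 0 := fun n h ↦
    hx ⟨X ^ n, pow_ne_zero n X_ne_zero, by rw [act_X_pow_algebraMap hφ, h, map_zero]⟩
  have hconst : ∀ n (c : F), polyOrbit g Δ x (n + 1) ≠ C c * polyOrbit g Δ x n := by
    intro n c h
    refine hx ⟨(X + C (-c)) * X ^ n,
      mul_ne_zero (monic_X_add_C _).ne_zero (pow_ne_zero n X_ne_zero), ?_⟩
    rw [act_mul, act_add, act_X_pow_algebraMap hφ, act_C, act_X_algebraMap hφ, ← polyOrbit_succ, h,
      ← map_mul, ← map_add, ← add_mul, ← C_add, add_neg_cancel, C_0, zero_mul, map_zero]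
  rintro n ⟨hn, hprim⟩
  by_contra hn1
  obtain ⟨k, rfl⟩ : ∃ k, n = k + 2 := ⟨n - 2, by simp only [Set.mem_singleton_iff] at hn1; lia⟩
  obtain ⟨p, hp, hdvd, hndvd⟩ := exists_prime_dvd_polyOrbit_not_dvd hΔ h0 hne hconst k
  refine hprim ⟨p, hp, by rwa [horb], fun i hi hpi ↦ hndvd ?_⟩
  rw [horb] at hpi
  exact hpi.trans (polyOrbit_dvd_of_le g Δ x (by lia))

end DrinfeldModule

theorem lemma5p1 {F : Type*} [Field F] [Fintype F] (φ : DrinfeldModule F (RatFunc F))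
    (g Δ : F[X]) (hrank : φ.HasRank 2)
    (hφ : φ.poly X = C (algebraMap F[X] (RatFunc F) X) * X
      + C (algebraMap F[X] (RatFunc F) g) * X ^ Fintype.card F
      + C (algebraMap F[X] (RatFunc F) Δ) * X ^ (Fintype.card F ^ 2))
    (hsplit : Δ.Splits)
    (hcop : IsCoprime (φ.act X 1).num (X * Δ))
    (x : F[X]) (hx : ¬ φ.IsTorsionPoint (algebraMap F[X] (RatFunc F) x)) :
    (φ.zsigmondySet (algebraMap F[X] (RatFunc F) x)).Finite ∧
      ∀ n ∈ φ.zsigmondySet (algebraMap F[X] (RatFunc F) x),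
        (n : ℝ) ≤ 6 * ((Fintype.card F : ℝ) ^ 2 - 1) * ((badPlaces Δ).ncard : ℝ) + 4
          + 1 / 2 * Real.logb (Fintype.card F)
              (2 + 2 * (g.natDegree : ℝ) + 2 * (Δ.natDegree : ℝ)) := by
  have hq : 1 < Fintype.card F := Fintype.one_lt_card
  have hΔ : Δ ≠ 0 := by
    rintro rfl
    have hle : (φ.poly X).natDegree ≤ Fintype.card F := by
      rw [hφ, map_zero, C_0, zero_mul, add_zero]
      refine natDegree_add_le_of_degree_le ?_ (natDegree_C_mul_X_pow_le _ _)
      exact (natDegree_C_mul_le _ _).trans (by rw [natDegree_X]; exact hq.le)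
    rw [hrank] at hle
    nlinarith
  have h0 : (g + Δ).eval 0 ≠ 0 := by
    have h1 : φ.act X 1 = algebraMap F[X] (RatFunc F) (X + (g + Δ)) := by
      rw [← map_one (algebraMap F[X] (RatFunc F)), DrinfeldModule.act_X_algebraMap hφ, step]
      simp only [one_pow, mul_one, add_assoc]
    rw [h1, RatFunc.num_algebraMap] at hcop
    intro h
    refine not_isUnit_X (hcop.isUnit_of_dvd' ?_ (dvd_mul_right X Δ))
    exact dvd_add dvd_rfl (X_dvd_iff.mpr (by rwa [coeff_zero_eq_eval_zero]))
  have hsub := DrinfeldModule.zsigmondySet_subset_singleton hΔ hφ h0 hx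
  refine ⟨(Set.finite_singleton 1).subset hsub, fun n hn ↦ ?_⟩
  obtain rfl : n = 1 := hsub hn
  have hq' : (1 : ℝ) < Fintype.card F := by exact_mod_cast hq
  have hlog : 0 ≤ Real.logb (Fintype.card F)
      (2 + 2 * (g.natDegree : ℝ) + 2 * (Δ.natDegree : ℝ)) :=
    Real.logb_nonneg hq' (by
      have hg := g.natDegree.cast_nonneg (α := ℝ)
      have hd := Δ.natDegree.cast_nonneg (α := ℝ)
      linarith)
  have hS : 0 ≤ 6 * ((Fintype.card F : ℝ) ^ 2 - 1) * ((badPlaces Δ).ncard : ℝ) :=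
    mul_nonneg (by nlinarith) (Nat.cast_nonneg _)
  push_cast
  linarith
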